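/- **Conventions.** An association scheme $S=(X,R)$ is a finite set $X$ with a partition $R$ of $X\times X$ into non-empty relations that contains the diagonal $\mathcal D_X$, is closed under transposition $r\mapsto r^\top$, and has intersection numbers: for $r,s,t\in R$ the number of $z\in X$ with $(x,z)\in r$ and $(z,y)\in s$ is the same for all $(x,y)\in t$. Let $D_r\in\{0,1\}^{X\times X}$ be the matrix of $r\in R$. Its Bose–Mesner algebra is the $\mathbb C$-algebra generated by $\{D_r\mid r\in R\}$; the $D_r$ form a basis of it. If this algebra is commutative (as for all schemes below), let $(E_s)_{s\in R'}$ be its primitive idempotents, i.e. its unique basis of pairwise orthogonal idempotents, and define $q_s\colon R\to\mathbb C$ by $E_s=\sum_{r\in R}q_s(r)D_r$. For $D\subseteq R$, the Delsarte linear program $\mathcal L_S(D)$ is: maximize $\sum_{r\in R}a_r$ over real $(a_r)_{r\in R}$ subject to $$a_{\mathcal D_X}=1,\qquad a_r=0\ (r\in R\setminus D),\qquad \sum_{r\in R}q_s(r)a_r\in\mathbb R_{\ge 0}\ (s\in R'),\qquad a_r\ge 0\ (r\in R).$$ Write $\mathsf{val}$ for the optimum value of a program. Let $\mathbb F$ be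 a finite field, let $n,\ell\ge 1$ be integers and let $d\in\{0,1,\dots,n\}$. The weak Hamming scheme $\mathbb H_n(\mathbb F)$ is the scheme on $\mathbb F^n$ with relations $r_i=\{(x,y)\mid \Delta(x,y)=i\}$, $0\le i\le n$, where $\Delta$ is the Hamming distance. Put $D_d=\{r_0,r_d,r_{d+1},\dots,r_n\}$ and $$\mathrm{DelsarteLP}^{\mathbb F}(n,d)=\mathcal L_{\mathbb H_n(\mathbb F)}(D_d).$$ Let $\mathbb H_n(\mathbb F)^{\ell,\mathbb F^\ell}$ be the scheme on $(\mathbb F^n)^\ell$ in which $(x,y)$ and $(x',y')$ are in the same relation if and only if, for every $k\in\mathbb F^\ell$, the words $\sum_{i=1}^\ell k_i(x_i-y_i)$ and $\sum_{i=1}^\ell k_i(x'_i-y'_i)$ have the same Hamming weight. Let $\widehat D_d^\ell$ be the set of those of its relations that are contained in $\{(x,y)\mid (x_i,y_i)\in s_i\text{ for all }i\}$ for some $s_1,\dots,s_\ell\in D_d$, and put $$\mathrm{KrawtchoukLP}^{\mathbb F}(n,d,\ell)=\mathcal L_{\mathbb H_n(\mathbb F)^{\ell,\mathbb F^\ell}}(\widehat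 D_d^\ell).$$ **Proposition (Lifting / Hierarchy Collapse).** For every finite field $\mathbb F$, all integers $n,\ell\ge 1$ and every $d\in\{0,1,\dots,n\}$, both linear programs attain their maximum, and $$\mathsf{val}\bigl(\mathrm{KrawtchoukLP}^{\mathbb F}(n,d,\ell)\bigr)^{1/\ell}=\mathsf{val}\bigl(\mathrm{DelsarteLP}^{\mathbb F}(n,d)\bigr).$$ -/

import Mathlib

/-! # Association schemes, Delsarte linear programs, and the Krawtchouk hierarchy -/

/-- An association scheme `(X, R)`: `R` is a partition of `X × X` into non-empty relations that
contains the diagonal, is closed under transposition and has intersection numbers. -/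
structure AssocScheme (X : Type*) where
  R : Set (Set (X × X))
  isPartition : Setoid.IsPartition R
  diag_mem : Set.diagonal X ∈ R
  transpose_mem : ∀ r ∈ R, Prod.swap ⁻¹' r ∈ R
  intersection_numbers : ∀ r ∈ R, ∀ s ∈ R, ∀ t ∈ R, ∃ p : ℕ, ∀ x y : X, (x, y) ∈ t →
    {z : X | (x, z) ∈ r ∧ (z, y) ∈ s}.ncard = p

namespace AssocScheme

section General

set_option linter.unusedSectionVars false

variable {X : Type*} (S : AssocScheme X)

/-- The diagonal relation, as an element of `R`. -/
def diag : S.R := ⟨Set.diagonal X, S.diag_mem⟩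

/-- The relation of the scheme that contains the pair `p`. -/
noncomputable def classOf (p : X × X) : S.R :=
  ⟨(S.isPartition.2 p).choose, (S.isPartition.2 p).choose_spec.1.1⟩

theorem mem_classOf (p : X × X) : p ∈ (S.classOf p : Set (X × X)) :=
  (S.isPartition.2 p).choose_spec.1.2

theorem eq_classOf {p : X × X} {r : Set (X × X)} (hr : r ∈ S.R) (hp : p ∈ r) :
    r = S.classOf p :=
  (S.isPartition.2 p).choose_spec.2 r ⟨hr, hp⟩

theorem classOf_eq_iff (p : X × X) (r : S.R) : S.classOf p = r ↔ p ∈ (r : Set (X × X)) := by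
  constructor
  · rintro rfl
    exact S.mem_classOf p
  · intro h
    exact Subtype.ext (S.eq_classOf r.2 h).symm

noncomputable instance [Finite X] : Fintype S.R := Fintype.ofFinite _

/-- The `0`-`1` matrix `D_r` of a relation `r`. -/
noncomputable def relMatrix (r : Set (X × X)) : Matrix X X ℂ :=
  Matrix.of fun x y => r.indicator (fun _ => (1 : ℂ)) (x, y)

variable [Fintype X] [DecidableEq X]

/-- The Bose--Mesner algebra: the complex algebra generated by the matrices `D_r`, `r ∈ R`. -/
noncomputable def boseMesner : Subalgebra ℂ (Matrix X X ℂ) :=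
  Algebra.adjoin ℂ (relMatrix '' S.R)

theorem sum_relMatrix_apply (q : S.R → ℂ) (x y : X) :
    (∑ r : S.R, q r • relMatrix (r : Set (X × X))) x y = q (S.classOf (x, y)) := by
  classical
  rw [Matrix.sum_apply, Finset.sum_eq_single (S.classOf (x, y))]
  · simp [relMatrix, S.mem_classOf (x, y)]
  · intro r _ hr
    have : (x, y) ∉ (r : Set (X × X)) := fun h => hr ((S.classOf_eq_iff _ r).2 h).symm
    simp [relMatrix, this]
  · simp

/-- The matrices `D_r` form a basis of the Bose--Mesner algebra: every element of the algebra is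
a unique linear combination of them. -/
theorem existsUnique_coeff {E : Matrix X X ℂ} (hE : E ∈ S.boseMesner) :
    ∃! q : S.R → ℂ, E = ∑ r : S.R, q r • relMatrix (r : Set (X × X)) := by
  classical
  suffices h : ∃ q : S.R → ℂ, E = ∑ r : S.R, q r • relMatrix (r : Set (X × X)) by
    obtain ⟨q, hq⟩ := h
    refine ⟨q, hq, fun q' hq' => funext fun r => ?_⟩
    obtain ⟨⟨x, y⟩, hp⟩ : (r : Set (X × X)).Nonempty := by
      rw [Set.nonempty_iff_ne_empty]
      intro h
      exact S.isPartition.1 (h ▸ r.2)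
    have hr := (S.classOf_eq_iff (x, y) r).2 hp
    rw [← hr, ← S.sum_relMatrix_apply q', ← S.sum_relMatrix_apply q]
    exact congrFun (congrFun (hq'.symm.trans hq) x) y
  induction hE using Algebra.adjoin_induction with
  | mem M hM =>
    obtain ⟨r, hr, rfl⟩ := hM
    refine ⟨Pi.single ⟨r, hr⟩ 1, ?_⟩
    rw [Finset.sum_eq_single ⟨r, hr⟩]
    · simp
    · intro b _ hb
      simp [hb]
    · simp
  | algebraMap c =>
    refine ⟨Pi.single S.diag c, ?_⟩
    ext x y
    rw [sum_relMatrix_apply, Matrix.algebraMap_matrix_apply]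
    by_cases h : x = y
    · have : S.classOf (x, y) = S.diag := (S.classOf_eq_iff _ _).2 h
      rw [this]
      simp [h]
    · have : S.classOf (x, y) ≠ S.diag := fun h' => h ((S.classOf_eq_iff _ _).1 h')
      simp [this, h]
  | add M N _ _ hM hN =>
    obtain ⟨q, rfl⟩ := hM
    obtain ⟨q', rfl⟩ := hN
    exact ⟨q + q', by simp [add_smul, Finset.sum_add_distrib]⟩
  | mul M N _ _ hM hN =>
    obtain ⟨q, rfl⟩ := hM
    obtain ⟨q', rfl⟩ := hN
    choose p hp using S.intersection_numbers
    refine ⟨fun t => ∑ r : S.R, ∑ s : S.R,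
      q r * q' s * (p r r.2 s s.2 t t.2 : ℂ), ?_⟩
    ext x y
    rw [sum_relMatrix_apply, Matrix.mul_apply]
    simp only [sum_relMatrix_apply]
    have key : ∀ r s : S.R, (p r r.2 s s.2 (S.classOf (x, y)) (S.classOf (x, y)).2 : ℂ) =
        ∑ z : X, if S.classOf (x, z) = r ∧ S.classOf (z, y) = s then (1 : ℂ) else 0 := by
      intro r s
      rw [← hp r r.2 s s.2 _ (S.classOf (x, y)).2 x y (S.mem_classOf _), Set.ncard_eq_toFinset_card',
        Finset.sum_boole]
      congr 2
      ext z
      simp [classOf_eq_iff]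
    simp only [key, Finset.mul_sum]
    have : ∀ r : S.R, ∑ s : S.R, ∑ z : X, q r * q' s *
        (if S.classOf (x, z) = r ∧ S.classOf (z, y) = s then (1 : ℂ) else 0) =
        ∑ z : X, if S.classOf (x, z) = r then q r * q' (S.classOf (z, y)) else 0 := by
      intro r
      rw [Finset.sum_comm]
      refine Finset.sum_congr rfl fun z _ => ?_
      by_cases h : S.classOf (x, z) = r <;> simp [h]
    simp only [this]
    rw [Finset.sum_comm]
    simp

/-- The primitive (minimal) idempotents of the Bose--Mesner algebra. For a commutative scheme these
are exactly the members `E_s` of the unique basis of the algebra that consists of mutually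
orthogonal idempotents. -/
structure IsPrimitiveIdempotent (E : Matrix X X ℂ) : Prop where
  mem : E ∈ S.boseMesner
  idem : E * E = E
  ne_zero : E ≠ 0
  minimal : ∀ G ∈ S.boseMesner, G * G = G → E * G = G → G * E = G → G = 0 ∨ G = E

/-- The `q`-function of `E`: the coefficients of `E` in the basis `(D_r)` of the Bose--Mesner
algebra, `E = ∑ r, q r • D_r`. -/
noncomputable def qFunction {E : Matrix X X ℂ} (hE : E ∈ S.boseMesner) : S.R → ℂ :=
  (S.existsUnique_coeff hE).choose

theorem eq_sum_qFunction {E : Matrix X X ℂ} (hE : E ∈ S.boseMesner) :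
    E = ∑ r : S.R, S.qFunction hE r • relMatrix (r : Set (X × X)) :=
  (S.existsUnique_coeff hE).choose_spec.1

/-- Feasible solutions of the Delsarte linear program of `(S, D)`. -/
structure IsDelsarteFeasible (D : Set S.R) (a : S.R → ℝ) : Prop where
  normalization : a S.diag = 1
  code : ∀ r : S.R, r ∉ D → a r = 0
  macWilliams : ∀ (E : Matrix X X ℂ) (hE : S.IsPrimitiveIdempotent E),
    ∃ t : ℝ, 0 ≤ t ∧ ∑ r : S.R, S.qFunction hE.mem r * (a r : ℂ) = (t : ℂ)
  nonneg : ∀ r : S.R, 0 ≤ a r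

/-- The objective values `∑ r, a r` of the feasible solutions of the Delsarte linear program. -/
def delsarteValues (D : Set S.R) : Set ℝ :=
  {v | ∃ a : S.R → ℝ, S.IsDelsarteFeasible D a ∧ v = ∑ r : S.R, a r}

/-- The optimum value of the Delsarte linear program of `(S, D)`. -/
noncomputable def delsarteVal (D : Set S.R) : ℝ := sSup (S.delsarteValues D)

end General

/-! ### Translation schemes and their refined tensor powers -/

section Translation

variable {X : Type*} [AddCommGroup X]

/-- All relations are invariant under the translations of the Abelian group `X`. -/
def IsTranslation (S : AssocScheme X) : Prop :=
  ∀ r ∈ S.R, ∀ x y z : X, (x, y) ∈ r ↔ (z + x, z + y) ∈ r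

/-- The function `f_S : X → R` with `(x, y) ∈ f_S (x - y)`. -/
noncomputable def transClass (S : AssocScheme X) (z : X) : S.R := S.classOf (z, 0)

theorem IsTranslation.mem_transClass {S : AssocScheme X} (hS : S.IsTranslation) (x y : X) :
    (x, y) ∈ (S.transClass (x - y) : Set (X × X)) := by
  have := (hS _ (S.transClass (x - y)).2 (x - y) 0 y).1 (S.mem_classOf _)
  simpa using this

theorem IsTranslation.classOf_eq {S : AssocScheme X} (hS : S.IsTranslation) (x y : X) :
    S.classOf (x, y) = S.transClass (x - y) :=
  (S.classOf_eq_iff _ _).2 (hS.mem_transClass x y)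

variable {K : Type*} [Ring K] [Module K X]

/-- `σ` is an automorphism of the scheme: it fixes every relation as a set. -/
def IsAut (S : AssocScheme X) (σ : X ≃ₗ[K] X) : Prop :=
  ∀ r ∈ S.R, Prod.map σ σ '' r = r

theorem IsAut.transClass_eq {S : AssocScheme X} {σ : X ≃ₗ[K] X} (hσ : S.IsAut σ) (z : X) :
    S.transClass (σ z) = S.transClass z := by
  refine (S.classOf_eq_iff _ _).2 ?_
  rw [← hσ _ (S.transClass z).2]
  exact ⟨(z, 0), S.mem_classOf _, by simp⟩

variable {l : ℕ}

/-- The function `f_{S,T} : X ^ l → R ^ T`, `f_{S,T} x k = f_S (∑ i, k i • x i)`. -/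
noncomputable def config (S : AssocScheme X) (T : Set (Fin l → K)) (x : Fin l → X) : T → S.R :=
  fun k => S.transClass (∑ i, (k : Fin l → K) i • x i)

/-- `f_{S,T}` factors through types: its fibres are the orbits of the `K`-linear automorphisms of
the scheme acting diagonally on `X ^ l`. -/
def FactorsThroughTypes (S : AssocScheme X) (T : Set (Fin l → K)) : Prop :=
  ∀ x y : Fin l → X, S.config T x = S.config T y ↔
    ∃ σ : X ≃ₗ[K] X, S.IsAut σ ∧ ∀ i, σ (x i) = y i

/-- The relation `r_h` on `X ^ l`, for `h : T → R`. -/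
def refinedRel (S : AssocScheme X) (T : Set (Fin l → K)) (h : T → S.R) :
    Set ((Fin l → X) × (Fin l → X)) :=
  {p | S.config T (p.1 - p.2) = h}

/-- The `T`-refined `l`th tensor power of a translation scheme. -/
def refinedPower [Finite X] (S : AssocScheme X) (T : Set (Fin l → K))
    (_hT : ∀ i : Fin l, Pi.single i 1 ∈ T) (hf : S.FactorsThroughTypes T) :
    AssocScheme (Fin l → X) where
  R := Set.range (S.refinedRel T) \ {∅}
  isPartition := by
    refine ⟨fun h => h.2 rfl, fun p => ⟨S.refinedRel T (S.config T (p.1 - p.2)),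
      ⟨⟨⟨_, rfl⟩, ?_⟩, rfl⟩, ?_⟩⟩
    · exact Set.Nonempty.ne_empty ⟨p, rfl⟩
    · rintro _ ⟨⟨⟨h, rfl⟩, -⟩, hp⟩
      rw [show S.config T (p.1 - p.2) = h from hp]
  diag_mem := by
    refine ⟨⟨S.config T 0, ?_⟩, Set.Nonempty.ne_empty ⟨(0, 0), rfl⟩⟩
    ext ⟨x, y⟩
    simp only [refinedRel, Set.mem_ofPred_eq, Set.mem_diagonal_iff]
    constructor
    · intro h
      funext i
      obtain ⟨σ, -, hσ⟩ := (hf _ _).1 h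
      have := hσ i
      simpa [sub_eq_zero] using this
    · rintro rfl
      simp
  transpose_mem := by
    rintro _ ⟨⟨h, rfl⟩, hne⟩
    obtain ⟨⟨x, y⟩, hxy⟩ := Set.nonempty_iff_ne_empty.2 hne
    refine ⟨⟨S.config T (y - x), ?_⟩, Set.Nonempty.ne_empty ⟨(y, x), hxy⟩⟩
    change S.config T (x - y) = h at hxy
    subst hxy
    ext ⟨u, v⟩
    simp only [refinedRel, Set.mem_ofPred_eq, Set.mem_preimage, Prod.swap, hf _ _]
    refine exists_congr fun σ => and_congr_right fun _ => forall_congr' fun i => ?_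
    rw [← neg_inj, ← map_neg]
    simp
  intersection_numbers := by
    rintro _ ⟨⟨h₁, rfl⟩, -⟩ _ ⟨⟨h₂, rfl⟩, -⟩ _ ⟨⟨h, rfl⟩, hne⟩
    obtain ⟨⟨x', y'⟩, hxy'⟩ := Set.nonempty_iff_ne_empty.2 hne
    refine ⟨{z | (x', z) ∈ S.refinedRel T h₁ ∧ (z, y') ∈ S.refinedRel T h₂}.ncard, ?_⟩
    intro x y hxy
    obtain ⟨σ, hσ, hσi⟩ := (hf _ _).1 ((show S.config T (x - y) = h from hxy).trans
      (show S.config T (x' - y') = h from hxy').symm)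
    have hc : ∀ u v : Fin l → X, (∀ i, σ (u i) = v i) → S.config T v = S.config T u :=
      fun u v huv => ((hf _ _).2 ⟨σ, hσ, huv⟩).symm
    refine Set.ncard_congr (fun z _ => fun i => σ (z i - y i) + y' i) ?_ ?_ ?_
    · rintro z ⟨h1, h2⟩
      refine ⟨(hc (x - z) _ fun i => ?_).trans h1, (hc (z - y) _ fun i => ?_).trans h2⟩
      · have := hσi i
        simp only [Pi.sub_apply, map_sub] at this ⊢
        rw [sub_eq_iff_eq_add] at this
        rw [this]
        abel
      · simp
    · intro a b _ _ hab
      funext i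
      have := congrFun hab i
      simpa using this
    · rintro w ⟨h1, h2⟩
      refine ⟨fun i => σ.symm (w i - y' i) + y i, ⟨?_, ?_⟩, by funext i; simp⟩
      · refine (hc _ (x' - w) fun i => ?_).symm.trans h1
        have := hσi i
        simp only [Pi.sub_apply, map_sub, map_add, LinearEquiv.apply_symm_apply] at this ⊢
        rw [sub_eq_iff_eq_add] at this
        rw [this]
        abel
      · refine (hc _ (w - y') fun i => ?_).symm.trans h2
        simp

end Translation

/-- The tensor product `r_1 ⊗ ⋯ ⊗ r_l` of relations on `X`, a relation on `X ^ l`. -/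
def tensorRel {X : Type*} {l : ℕ} (r : Fin l → Set (X × X)) :
    Set ((Fin l → X) × (Fin l → X)) :=
  {p | ∀ i, (p.1 i, p.2 i) ∈ r i}

end AssocScheme

/-! ### The weak Hamming scheme -/

/-- The relation `r_i` on `G ^ n`: Hamming distance equal to `i`. -/
def hammingRel (G : Type*) [DecidableEq G] (n i : ℕ) : Set ((Fin n → G) × (Fin n → G)) :=
  {p | hammingDist p.1 p.2 = i}

theorem exists_perm_of_card_fiber {α β : Type*} [Fintype α] (f g : α → β)
    (h : ∀ b, Nat.card {a // f a = b} = Nat.card {a // g a = b}) :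
    ∃ π : Equiv.Perm α, ∀ a, g (π a) = f a := by
  classical
  have e : ∀ b, Nonempty ({a // f a = b} ≃ {a // g a = b}) := fun b => Finite.card_eq.1 (h b)
  refine ⟨(Equiv.sigmaFiberEquiv f).symm.trans
    ((Equiv.sigmaCongrRight fun b => (e b).some).trans (Equiv.sigmaFiberEquiv g)), fun a => ?_⟩
  exact ((e (f a)).some ⟨a, rfl⟩).2

theorem hammingDist_perm {G : Type*} [DecidableEq G] {n : ℕ} (π : Equiv.Perm (Fin n))
    (τ : Fin n → G → G) (hτ : ∀ i, Function.Injective (τ i)) (x y u v : Fin n → G)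
    (hu : ∀ i, u (π i) = τ i (x i)) (hv : ∀ i, v (π i) = τ i (y i)) :
    hammingDist u v = hammingDist x y := by
  unfold hammingDist
  symm
  refine Finset.card_bij (fun i _ => π i) ?_ (fun _ _ _ _ h => π.injective h) ?_
  · intro i hi
    simpa [hu, hv, (hτ i).eq_iff] using hi
  · intro j hj
    refine ⟨π.symm j, ?_, by simp⟩
    have h1 := hu (π.symm j)
    have h2 := hv (π.symm j)
    simp only [Equiv.apply_symm_apply] at h1 h2
    simpa [h1, h2, (hτ _).eq_iff] using hj

theorem exists_hamming_isometry {G : Type*} [AddCommGroup G] [DecidableEq G] {n : ℕ}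
    {x y x' y' : Fin n → G} (h : hammingDist x y = hammingDist x' y') :
    ∃ e : (Fin n → G) → (Fin n → G), Function.Bijective e ∧ e x = x' ∧ e y = y' ∧
      ∀ u v, hammingDist (e u) (e v) = hammingDist u v := by
  obtain ⟨π, hπ⟩ := exists_perm_of_card_fiber (fun i => decide (x i = y i))
    (fun i => decide (x' i = y' i)) (by
      have h1 : Nat.card {i // decide (x i = y i) = false} =
          Nat.card {i // decide (x' i = y' i) = false} := by
        simp only [decide_eq_false_iff_not, Nat.card_eq_fintype_card, Fintype.card_subtype]
        exact h
      have h2 : ∀ a b : Fin n → G, Nat.card {i // decide (a i = b i) = true} +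
          Nat.card {i // decide (a i = b i) = false} = n := by
        intro a b
        simp only [decide_eq_false_iff_not, decide_eq_true_eq, Nat.card_eq_fintype_card,
          Fintype.card_subtype]
        simpa using Finset.card_filter_add_card_filter_not (s := Finset.univ) (fun i => a i = b i)
      intro b
      cases b
      · exact h1
      · have := h2 x y
        have := h2 x' y'
        omega)
  have hπ' : ∀ i, x' (π i) = y' (π i) ↔ x i = y i := fun i => by simpa using hπ i
  let τ : Fin n → G ≃ G := fun i =>
    (Equiv.subRight (y i)).trans ((Equiv.swap (x i - y i) (x' (π i) - y' (π i))).trans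
      (Equiv.addRight (y' (π i))))
  let e : (Fin n → G) ≃ (Fin n → G) :=
    (Equiv.piCongrRight τ).trans (Equiv.arrowCongr π (Equiv.refl G))
  have he : ∀ u i, e u (π i) = τ i (u i) := fun u i => by simp [e, Equiv.arrowCongr]
  refine ⟨e, e.bijective, ?_, ?_, fun u v =>
    hammingDist_perm π (fun i => τ i) (fun i => (τ i).injective) u v _ _ (he u) (he v)⟩
  · funext j
    obtain ⟨i, rfl⟩ := π.surjective j
    rw [he]
    simp [τ]
  · funext j
    obtain ⟨i, rfl⟩ := π.surjective j
    rw [he]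
    by_cases hi : x i = y i
    · simp [τ, hi, (hπ' i).2 hi]
    · have h1 : (0 : G) ≠ x i - y i := fun h => hi (sub_eq_zero.1 h.symm)
      have h2 : (0 : G) ≠ x' (π i) - y' (π i) := fun h => hi ((hπ' i).1 (sub_eq_zero.1 h.symm))
      simp [τ, Equiv.swap_apply_of_ne_of_ne h1 h2]

/-- The weak Hamming scheme of order `n` over a non-trivial finite Abelian group `G`. -/
def hammingScheme (G : Type*) [AddCommGroup G] [Finite G] [DecidableEq G] [Nontrivial G] (n : ℕ) :
    AssocScheme (Fin n → G) where
  R := {r | ∃ i ≤ n, r = hammingRel G n i}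
  isPartition := by
    refine ⟨?_, fun p => ⟨hammingRel G n (hammingDist p.1 p.2), ⟨⟨_, ?_, rfl⟩, rfl⟩, ?_⟩⟩
    · rintro ⟨i, hi, h⟩
      obtain ⟨g, hg⟩ := exists_ne (0 : G)
      have : ((fun j : Fin n => if (j : ℕ) < i then g else 0), (0 : Fin n → G)) ∈
          hammingRel G n i := by
        simp only [hammingRel, hammingDist, Set.mem_ofPred_eq, Pi.zero_apply, ne_eq, ite_eq_right_iff,
          hg, imp_false, not_not]
        exact Fin.card_filter_val_lt.trans (min_eq_right hi)
      rw [← h] at this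
      exact this
    · simpa using hammingDist_le_card_fintype (x := p.1) (y := p.2)
    · rintro _ ⟨⟨i, -, rfl⟩, hp⟩
      rw [show hammingDist p.1 p.2 = i from hp]
  diag_mem := ⟨0, Nat.zero_le _, by ext p; simp [hammingRel]⟩
  transpose_mem := by
    rintro _ ⟨i, hi, rfl⟩
    exact ⟨i, hi, by ext p; simp [hammingRel, hammingDist_comm]⟩
  intersection_numbers := by
    rintro _ ⟨i, -, rfl⟩ _ ⟨j, -, rfl⟩ t ⟨k, -, rfl⟩
    rcases Set.eq_empty_or_nonempty (hammingRel G n k) with h | ⟨⟨x', y'⟩, hxy'⟩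
    · exact ⟨0, fun x y hxy => by rw [h] at hxy; exact hxy.elim⟩
    refine ⟨{z | (x', z) ∈ hammingRel G n i ∧ (z, y') ∈ hammingRel G n j}.ncard, ?_⟩
    intro x y hxy
    obtain ⟨e, he, rfl, rfl, hd⟩ := exists_hamming_isometry
      ((show hammingDist x y = k from hxy).trans (show hammingDist x' y' = k from hxy').symm)
    refine Set.ncard_congr (fun z _ => e z) ?_ (fun _ _ _ _ h => he.1 h) ?_
    · rintro z ⟨h1, h2⟩
      exact ⟨(hd _ _).trans h1, (hd _ _).trans h2⟩
    · rintro w ⟨h1, h2⟩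
      obtain ⟨z, rfl⟩ := he.2 w
      exact ⟨z, ⟨(hd _ _).symm.trans h1, (hd _ _).symm.trans h2⟩, rfl⟩

theorem hammingScheme_isTranslation (G : Type*) [AddCommGroup G] [Finite G] [DecidableEq G]
    [Nontrivial G] (n : ℕ) : (hammingScheme G n).IsTranslation := by
  rintro _ ⟨i, -, rfl⟩ x y z
  simp only [hammingRel, Set.mem_ofPred_eq]
  rw [hammingDist_perm (Equiv.refl _) (fun i g => z i + g) (fun i => add_right_injective _) x y
    (z + x) (z + y) (fun _ => rfl) (fun _ => rfl)]

/-- The set `D_d = {r_0, r_d, r_{d+1}, …, r_n}` of relations of the weak Hamming scheme. -/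
def distRels (G : Type*) [AddCommGroup G] [Finite G] [DecidableEq G] [Nontrivial G] (n d : ℕ) :
    Set (hammingScheme G n).R :=
  {r | ∃ i ≤ n, (i = 0 ∨ d ≤ i) ∧ (r : Set _) = hammingRel G n i}

section FiniteField

variable (F : Type*) [Field F] [Fintype F] [DecidableEq F]

open Classical in
/-- The number of common zeros `k` of the linear forms `k ⬝ u` and `k ⬝ v`. -/
theorem card_common_zeros {l : ℕ} (u : Fin l → F) :
    ∃ P Q : ℕ, Q < P ∧ ∀ v : Fin l → F,
      (Finset.univ.filter fun k : Fin l → F => k ⬝ᵥ u = 0 ∧ k ⬝ᵥ v = 0).card =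
        if v ∈ Submodule.span F {u} then P else Q := by
  classical
  let φ : (Fin l → F) → ((Fin l → F) →ₗ[F] F) := fun v => (dotProductBilin F F).flip v
  have hφ : ∀ v k, φ v k = k ⬝ᵥ v := fun v k => rfl
  let W : Submodule F (Fin l → F) := LinearMap.ker (φ u)
  have hq : 1 < Fintype.card F := Fintype.one_lt_card
  have hWpos : 0 < Nat.card W := Nat.card_pos
  have hdiv : Nat.card W / Fintype.card F < Nat.card W := Nat.div_lt_self hWpos hq
  refine ⟨Nat.card W, Nat.card W / Fintype.card F, hdiv, fun v => ?_⟩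
  have hcard : (Finset.univ.filter fun k : Fin l → F => k ⬝ᵥ u = 0 ∧ k ⬝ᵥ v = 0).card =
      Nat.card (LinearMap.ker ((φ v).comp W.subtype)) := by
    rw [← Fintype.card_subtype, ← Nat.card_eq_fintype_card]
    refine Nat.card_congr ⟨fun k => ⟨⟨k.1, k.2.1⟩, k.2.2⟩, fun k => ⟨k.1.1, k.1.2, k.2⟩,
      fun _ => rfl, fun _ => rfl⟩
  rw [hcard]
  split_ifs with hv
  · obtain ⟨c, rfl⟩ := Submodule.mem_span_singleton.1 hv
    have : LinearMap.ker ((φ (c • u)).comp W.subtype) = ⊤ := by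
      rw [LinearMap.ker_eq_top]
      ext k
      have hk : (k : Fin l → F) ⬝ᵥ u = 0 := k.2
      simp [hφ, hk]
    rw [this]
    exact Nat.card_congr (Equiv.Set.univ _)
  · obtain ⟨f, hf, hfu⟩ := Submodule.exists_le_ker_of_notMem hv
    have hk : ∀ w, f w = (fun i => f (Pi.single i 1)) ⬝ᵥ w := by
      intro w
      conv_lhs => rw [← Finset.univ_sum_single w]
      rw [map_sum]
      refine Finset.sum_congr rfl fun i _ => ?_
      have : (Pi.single i (w i) : Fin l → F) = w i • Pi.single i 1 := by
        rw [← Pi.single_smul]; simp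
      simp [this, mul_comm]
    have hkW : (fun i => f (Pi.single i 1)) ∈ W := by
      change _ ⬝ᵥ u = 0
      rw [← hk]
      exact hfu (Submodule.mem_span_singleton_self u)
    have hsurj : Function.Surjective ((φ v).comp W.subtype) := by
      apply LinearMap.surjective
      intro h0
      have := LinearMap.congr_fun h0 ⟨_, hkW⟩
      apply hf
      rw [hk]
      exact this
    have h1 := Submodule.card_eq_card_quotient_mul_card (LinearMap.ker ((φ v).comp W.subtype))
    have h2 : Nat.card (W ⧸ LinearMap.ker ((φ v).comp W.subtype)) = Fintype.card F := by
      rw [← Nat.card_eq_fintype_card]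
      exact Nat.card_congr (LinearMap.quotKerEquivOfSurjective _ hsurj).toEquiv
    rw [h2] at h1
    rw [h1]
    exact (Nat.mul_div_cancel _ (by omega)).symm

theorem hammingScheme_transClass_eq_iff {n : ℕ} (z w : Fin n → F) :
    (hammingScheme F n).transClass z = (hammingScheme F n).transClass w ↔
      hammingDist z 0 = hammingDist w 0 := by
  have hcl : ∀ u : Fin n → F, ((hammingScheme F n).transClass u : Set _) =
      hammingRel F n (hammingDist u 0) := fun u =>
    ((hammingScheme F n).eq_classOf (p := (u, 0)) ⟨_, by
      simpa using hammingDist_le_card_fintype (x := u) (y := (0 : Fin n → F)), rfl⟩ rfl).symm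
  constructor
  · intro h
    have h1 : (z, (0 : Fin n → F)) ∈ ((hammingScheme F n).transClass w : Set _) := by
      rw [← h]
      exact AssocScheme.mem_classOf _ _
    rw [hcl] at h1
    exact h1
  · intro h
    exact Subtype.ext (by rw [hcl, hcl, h])

/-- The weights of all linear combinations of an `l`-tuple of words determine the tuple up to a
monomial transformation. -/
theorem exists_monomial {n l : ℕ} {x y : Fin l → Fin n → F}
    (h : ∀ k : Fin l → F, hammingDist (∑ i, k i • x i) 0 = hammingDist (∑ i, k i • y i) 0) :
    ∃ (π : Equiv.Perm (Fin n)) (c : Fin n → Fˣ), ∀ i j, y i (π j) = c j • x i j := by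
  classical
  let col : (Fin l → Fin n → F) → Fin n → Fin l → F := fun x j i => x i j
  have hz : ∀ (x : Fin l → Fin n → F) (k : Fin l → F),
      (Finset.univ.filter fun j => k ⬝ᵥ col x j = 0).card + hammingDist (∑ i, k i • x i) 0 = n := by
    intro x k
    have h1 := Finset.card_filter_add_card_filter_not (s := (Finset.univ : Finset (Fin n)))
      (fun j => k ⬝ᵥ col x j = 0)
    have h2 : hammingDist (∑ i, k i • x i) 0 =
        (Finset.univ.filter fun j => ¬ k ⬝ᵥ col x j = 0).card := by
      unfold hammingDist
      congr 1
      ext j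
      simp [dotProduct, col]
    rw [h2, h1]
    simp
  have hzz : ∀ k : Fin l → F, (Finset.univ.filter fun j => k ⬝ᵥ col x j = 0).card =
      (Finset.univ.filter fun j => k ⬝ᵥ col y j = 0).card := by
    intro k
    have h1 := hz x k
    have h2 := hz y k
    have h3 := h k
    omega
  have hspan : ∀ u : Fin l → F,
      (Finset.univ.filter fun j => col x j ∈ Submodule.span F {u}).card =
      (Finset.univ.filter fun j => col y j ∈ Submodule.span F {u}).card := by
    intro u
    obtain ⟨P, Q, hPQ, hc⟩ := card_common_zeros F u
    have key : ∀ x : Fin l → Fin n → F,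
        ∑ k ∈ Finset.univ.filter (fun k : Fin l → F => k ⬝ᵥ u = 0),
          (Finset.univ.filter fun j => k ⬝ᵥ col x j = 0).card =
        (Finset.univ.filter fun j => col x j ∈ Submodule.span F {u}).card * P +
          (Finset.univ.filter fun j => ¬ col x j ∈ Submodule.span F {u}).card * Q := by
      intro x
      simp only [Finset.card_filter _ (Finset.univ : Finset (Fin n))]
      rw [Finset.sum_comm]
      have : ∀ j, (∑ k ∈ Finset.univ.filter (fun k : Fin l → F => k ⬝ᵥ u = 0),
          if k ⬝ᵥ col x j = 0 then 1 else 0) =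
          if col x j ∈ Submodule.span F {u} then P else Q := by
        intro j
        rw [← hc (col x j), ← Finset.filter_filter, Finset.card_filter]
      simp only [this]
      rw [Finset.sum_ite]
      simp only [Finset.sum_const, smul_eq_mul, ← Finset.card_filter]
    have hk := key x
    rw [Finset.sum_congr rfl fun k _ => hzz k, key y] at hk
    have hn : ∀ x : Fin l → Fin n → F,
        (Finset.univ.filter fun j => col x j ∈ Submodule.span F {u}).card +
          (Finset.univ.filter fun j => ¬ col x j ∈ Submodule.span F {u}).card = n := by
      intro x
      simpa using Finset.card_filter_add_card_filter_not (s := (Finset.univ : Finset (Fin n)))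
        (fun j => col x j ∈ Submodule.span F {u})
    have hx := hn x
    have hy := hn y
    generalize (Finset.univ.filter fun j => col x j ∈ Submodule.span F {u}).card = a at *
    generalize (Finset.univ.filter fun j => ¬ col x j ∈ Submodule.span F {u}).card = a' at *
    generalize (Finset.univ.filter fun j => col y j ∈ Submodule.span F {u}).card = b at *
    generalize (Finset.univ.filter fun j => ¬ col y j ∈ Submodule.span F {u}).card = b' at *
    obtain ⟨t, rfl⟩ := Nat.exists_eq_add_of_lt hPQ
    have ha : a * (t + 1) = b * (t + 1) := by nlinarith
    exact Nat.eq_of_mul_eq_mul_right (Nat.succ_pos t) ha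
  let cls : (Fin l → F) → Quotient (MulAction.orbitRel Fˣ (Fin l → F)) := fun v => Quotient.mk _ v
  have hcls : ∀ v u : Fin l → F, cls v = cls u ↔ ∃ c : Fˣ, c • u = v := by
    intro v u
    exact Quotient.eq.trans (MulAction.orbitRel_apply.trans Iff.rfl)
  have hfib : ∀ (x : Fin l → Fin n → F) (u : Fin l → F), u ≠ 0 →
      Nat.card {j // cls (col x j) = cls u} +
        (Finset.univ.filter fun j => col x j ∈ Submodule.span F {(0 : Fin l → F)}).card =
      (Finset.univ.filter fun j => col x j ∈ Submodule.span F {u}).card := by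
    intro x u hu
    rw [Nat.card_eq_fintype_card, Fintype.card_subtype, ← Finset.card_union_of_disjoint]
    · congr 1
      ext j
      simp only [Finset.mem_union, Finset.mem_filter, Finset.mem_univ, true_and, hcls,
        Submodule.mem_span_singleton, smul_zero, exists_const]
      constructor
      · rintro (⟨c, hc⟩ | h0)
        · exact ⟨c, hc⟩
        · exact ⟨0, by rw [zero_smul, h0]⟩
      · rintro ⟨c, hc⟩
        by_cases h0 : c = 0
        · right
          rw [← hc, h0, zero_smul]
        · exact Or.inl ⟨Units.mk0 c h0, hc⟩
    · rw [Finset.disjoint_filter]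
      intro j _ h1 h2
      obtain ⟨c, hc⟩ := (hcls _ _).1 h1
      simp only [Submodule.mem_span_singleton, smul_zero, exists_const] at h2
      rw [← h2] at hc
      exact hu ((smul_eq_zero_iff_eq c).1 hc)
  have hfib0 : ∀ (x : Fin l → Fin n → F), Nat.card {j // cls (col x j) = cls 0} =
        (Finset.univ.filter fun j => col x j ∈ Submodule.span F {(0 : Fin l → F)}).card := by
    intro x
    rw [Nat.card_eq_fintype_card, Fintype.card_subtype]
    congr 1
    ext j
    simp only [Finset.mem_filter, Finset.mem_univ, true_and, hcls, Submodule.mem_span_singleton,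
      smul_zero, exists_const]
  obtain ⟨π, hπ⟩ := exists_perm_of_card_fiber (fun j => cls (col x j)) (fun j => cls (col y j)) (by
    intro b
    obtain ⟨u, rfl⟩ := Quotient.exists_rep b
    change Nat.card {j // cls (col x j) = cls u} = Nat.card {j // cls (col y j) = cls u}
    by_cases hu : u = 0
    · rw [hu, hfib0, hfib0, hspan]
    · have h1 := hfib x u hu
      have h2 := hfib y u hu
      rw [hspan, hspan] at h1
      omega)
  choose c hc using fun j => (hcls _ _).1 (hπ j)
  exact ⟨π, c, fun i j => (congrFun (hc j) i).symm⟩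

theorem hammingScheme_factorsThroughTypes (n l : ℕ) :
    (hammingScheme F n).FactorsThroughTypes (Set.univ : Set (Fin l → F)) := by
  intro x y
  constructor
  · intro h
    obtain ⟨π, c, hc⟩ := exists_monomial F (x := x) (y := y) (fun k =>
      (hammingScheme_transClass_eq_iff F _ _).1 (congrFun h ⟨k, trivial⟩))
    let σ : (Fin n → F) ≃ₗ[F] (Fin n → F) :=
      (LinearEquiv.piCongrRight fun j => LinearEquiv.smulOfUnit (c j)).trans
        (LinearEquiv.funCongrLeft F F π.symm)
    have hσ : ∀ z j, σ z (π j) = c j • z j := fun z j => by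
      simp [σ, LinearEquiv.funCongrLeft_apply, LinearMap.funLeft_apply, LinearEquiv.smulOfUnit,
        Units.smul_def]
    have hd : ∀ u v, hammingDist (σ u) (σ v) = hammingDist u v := fun u v =>
      hammingDist_perm π (fun j g => c j • g) (fun j => MulAction.injective (c j)) u v _ _
        (hσ u) (hσ v)
    refine ⟨σ, ?_, fun i => ?_⟩
    · rintro _ ⟨i, -, rfl⟩
      ext ⟨u, v⟩
      constructor
      · rintro ⟨⟨u', v'⟩, h', hp⟩
        obtain ⟨rfl, rfl⟩ := Prod.mk.inj hp
        exact (hd u' v').trans h'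
      · intro h'
        refine ⟨(σ.symm u, σ.symm v), ?_, by simp⟩
        refine (hd _ _).symm.trans ?_
        rw [LinearEquiv.apply_symm_apply, LinearEquiv.apply_symm_apply]
        exact h'
    · funext j
      obtain ⟨j, rfl⟩ := π.surjective j
      rw [hσ, hc]
  · rintro ⟨σ, hσ, h⟩
    funext k
    have : ∑ i, (k : Fin l → F) i • y i = σ (∑ i, (k : Fin l → F) i • x i) := by
      simp [map_sum, h]
    unfold AssocScheme.config
    rw [this, hσ.transClass_eq]

/-- The refined tensor power `ℍ_n(F)^{l, F^l}` of the weak Hamming scheme. -/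
def krawtchoukScheme (n l : ℕ) : AssocScheme (Fin l → Fin n → F) :=
  (hammingScheme F n).refinedPower (Set.univ : Set (Fin l → F)) (fun _ => trivial)
    (hammingScheme_factorsThroughTypes F n l)

/-- The relations of `ℍ_n(F)^{l, F^l}` contained in some `r_1 ⊗ ⋯ ⊗ r_l` with all `r_i ∈ D_d`. -/
def tensorDistRels (n d l : ℕ) : Set (krawtchoukScheme F n l).R :=
  {r | ∃ s : Fin l → (hammingScheme F n).R, (∀ i, s i ∈ distRels F n d) ∧
    (r : Set _) ⊆ AssocScheme.tensorRel fun i => (s i : Set ((Fin n → F) × (Fin n → F)))}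

/-- Objective values of the feasible solutions of `DelsarteLP^F(n,d)`. -/
def delsarteLPValues (n d : ℕ) : Set ℝ := (hammingScheme F n).delsarteValues (distRels F n d)

/-- The optimum value of `DelsarteLP^F(n,d)`. -/
noncomputable def delsarteLPVal (n d : ℕ) : ℝ := (hammingScheme F n).delsarteVal (distRels F n d)

/-- Objective values of the feasible solutions of `KrawtchoukLP^F(n,d,l)`. -/
def krawtchoukLPValues (n d l : ℕ) : Set ℝ :=
  (krawtchoukScheme F n l).delsarteValues (tensorDistRels F n d l)

/-- The optimum value of `KrawtchoukLP^F(n,d,l)`. -/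
noncomputable def krawtchoukLPVal (n d l : ℕ) : ℝ :=
  (krawtchoukScheme F n l).delsarteVal (tensorDistRels F n d l)

end FiniteField

/-! The linear program of a symmetric translation scheme on an abelian group `X` can be rewritten as
an optimization over functions `f` on `X` that are constant on classes (`IsDelsarteFunction`).
Primitive idempotents are orthogonal projections, and together they detect every eigenvalue of the
matrix `(f (x - y))`, so the MacWilliams inequalities say exactly that this matrix is positive
semidefinite (`posSemidef_transMatrix_iff`). No characters are needed. The maximum is attained
because the feasible functions form a compact set: positive semidefiniteness gives `f x ≤ f 0 = 1`.

Let `v` be the optimum for `X`. For the bound `≥ v ^ l` on `X ^ l`, the function `∏ i, f (z i)` is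
feasible when `f` is, by the Schur product theorem, and its sum is a power.

For `≤ v ^ l`, let `g` be feasible on `X ^ l`. Restrict `g` to the tuples that vanish after
coordinate `k` and push it forward to that coordinate. After division by its value at `0`, the
result is feasible for `X`: positivity survives summation over the fibres of a homomorphism, and
invariance holds because words in the same class are exchanged by an automorphism, whose diagonal
action preserves `g`. Hence freeing coordinate `k` multiplies the sum by at most `v`
(`sum_le_of_marginal`). Starting from `g 0 = 1` and freeing all `l` coordinates gives `v ^ l`. -/

open scoped ComplexOrder

namespace AssocScheme

/-! ### Primitive idempotents and eigenprojections in the Bose–Mesner algebra. -/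

section Primitive

variable {X : Type*} [Fintype X] [DecidableEq X] (S : AssocScheme X)

theorem mem_boseMesner_iff (M : Matrix X X ℂ) :
    M ∈ S.boseMesner ↔ ∃ q : S.R → ℂ, ∀ x y, M x y = q (S.classOf (x, y)) := by
  constructor
  · intro h
    obtain ⟨q, hq, -⟩ := S.existsUnique_coeff h
    exact ⟨q, fun x y => by rw [hq, sum_relMatrix_apply]⟩
  · rintro ⟨q, hq⟩
    have : M = ∑ r : S.R, q r • relMatrix (r : Set (X × X)) := by
      ext x y
      rw [sum_relMatrix_apply, hq]
    rw [this]
    exact sum_mem fun r _ => Subalgebra.smul_mem _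
      (Algebra.subset_adjoin (Set.mem_image_of_mem relMatrix r.2)) _

theorem apply_eq_qFunction {E : Matrix X X ℂ} (hE : E ∈ S.boseMesner) (x y : X) :
    E x y = S.qFunction hE (S.classOf (x, y)) := by
  conv_lhs => rw [S.eq_sum_qFunction hE]
  rw [sum_relMatrix_apply]

/-- Below every nonzero idempotent of the Bose--Mesner algebra there is a primitive one. -/
theorem exists_isPrimitiveIdempotent {P : Matrix X X ℂ} (hP : P ∈ S.boseMesner)
    (hidem : P * P = P) (hne : P ≠ 0) : ∃ E, S.IsPrimitiveIdempotent E ∧ P * E = E := by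
  let C : Set (Matrix X X ℂ) := {G | G ∈ S.boseMesner ∧ G * G = G ∧ G ≠ 0 ∧ P * G = G}
  -- `E` has minimal range among the non-zero idempotents below `P`; finite dimension makes
  -- inclusion of ranges well-founded.
  obtain ⟨E, ⟨hE, hEE, hE0, hPE⟩, hmin⟩ := (InvImage.wf (fun G : Matrix X X ℂ =>
    LinearMap.range G.mulVecLin) (wellFounded_lt (α := Submodule ℂ (X → ℂ)))).has_min C
      ⟨P, hP, hidem, hne, hidem⟩
  refine ⟨E, ⟨hE, hEE, hE0, fun G hG hGG hEG hGE => ?_⟩, hPE⟩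
  by_contra! h
  refine hmin G ⟨hG, hGG, h.1, by rw [← hEG, ← mul_assoc, hPE]⟩ (lt_of_le_of_ne ?_ ?_)
  · beta_reduce
    rw [← hEG, Matrix.mulVecLin_mul]
    exact LinearMap.range_comp_le_range _ _
  · intro hr
    -- If the ranges agree, every column of `E` lies in the range of `G` and is fixed by `G`, so `G
    -- = G * E = E`.
    refine h.2 (hGE.symm.trans (Matrix.ext_of_mulVec_single fun i => ?_))
    have : E.mulVecLin (Pi.single i 1) ∈ LinearMap.range G.mulVecLin := by
      rw [show LinearMap.range G.mulVecLin = LinearMap.range E.mulVecLin from hr]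
      exact ⟨_, rfl⟩
    obtain ⟨w, hw⟩ := this
    simp only [Matrix.mulVecLin_apply] at hw
    rw [← Matrix.mulVec_mulVec, ← hw, Matrix.mulVec_mulVec, hGG]

/-- The eigenprojections of a Hermitian matrix `A` lie in every subalgebra containing `A`. -/
theorem _root_.Matrix.IsHermitian.exists_eigenprojection {A : Matrix X X ℂ} (hA : A.IsHermitian)
    {B : Subalgebra ℂ (Matrix X X ℂ)} (hB : A ∈ B) (i : X) :
    ∃ P ∈ B, P * P = P ∧ P ≠ 0 ∧ A * P = (hA.eigenvalues i : ℂ) • P := by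
  classical
  let φ := Unitary.conjStarAlgAut ℂ (Matrix X X ℂ) hA.eigenvectorUnitary
  let s : Finset ℂ := Finset.univ.image fun j => (hA.eigenvalues j : ℂ)
  let v : ℂ → ℂ := fun z => if z = hA.eigenvalues i then 1 else 0
  -- `p` is `1` at the chosen eigenvalue and `0` at the others, so `p(A)` is the eigenprojection.
  -- Being a polynomial in `A`, it stays in `B`.
  let p := Lagrange.interpolate s id v
  let D : Matrix X X ℂ := Matrix.diagonal fun j => (hA.eigenvalues j : ℂ)
  have hAD : A = φ D := hA.spectral_theorem
  have hp : ∀ j, p.eval (hA.eigenvalues j : ℂ) = v (hA.eigenvalues j) := fun j =>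
    Lagrange.eval_interpolate_at_node v (Function.injective_id.injOn)
      (Finset.mem_image_of_mem _ (Finset.mem_univ j))
  have hpD : Polynomial.aeval D p = Matrix.diagonal fun j => v (hA.eigenvalues j) := by
    have h1 : D = Matrix.diagonalAlgHom ℂ (fun j => (hA.eigenvalues j : ℂ)) := rfl
    rw [h1, Polynomial.aeval_algHom_apply, Matrix.diagonalAlgHom_apply]
    congr 1
    funext j
    rw [← hp j, ← Polynomial.coe_aeval_eq_eval]
    exact (Polynomial.aeval_algHom_apply (Pi.evalAlgHom ℂ (fun _ : X => ℂ) j) _ p).symm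
  have hP : Polynomial.aeval A p = φ (Matrix.diagonal fun j => v (hA.eigenvalues j)) := by
    rw [← hpD]
    refine (congrArg (fun M => Polynomial.aeval M p) hAD).trans ?_
    exact Polynomial.aeval_algHom_apply (φ.toAlgEquiv : Matrix X X ℂ →ₐ[ℂ] Matrix X X ℂ) D p
  refine ⟨Polynomial.aeval A p, 
    Polynomial.coe_aeval_mk_apply (p := p) (h := hB) ▸ (Polynomial.aeval (⟨A, hB⟩ : B) p).2, ?_, ?_, ?_⟩
  · rw [hP, ← map_mul, Matrix.diagonal_mul_diagonal]
    congr 2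
    funext j
    simp [v]
  · rw [hP, Ne, map_eq_zero_iff φ φ.injective]
    intro h
    have := congrFun (congrFun h i) i
    simp [v] at this
  · rw [hP]
    refine (congrArg (fun M => M * φ _) hAD).trans ?_
    rw [← map_mul, ← map_smul, Matrix.diagonal_mul_diagonal, ← Matrix.diagonal_smul]
    congr 2
    funext j
    by_cases h : hA.eigenvalues j = hA.eigenvalues i <;> simp [v, h]

end Primitive

/-! ### Delsarte functions on symmetric translation schemes -/

section Translation

variable {X : Type*} [AddCommGroup X]

/-- The matrix `(x, y) ↦ f (x - y)` of a function on an Abelian group. -/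
def transMatrix (f : X → ℝ) : Matrix X X ℂ := Matrix.of fun x y => (f (x - y) : ℂ)

/-- Feasible solutions of the Delsarte linear program, as functions on the underlying group. -/
structure IsDelsarteFunction (S : AssocScheme X) (D : Set S.R) (f : X → ℝ) : Prop where
  map_zero : f 0 = 1
  invariant : ∀ x y, S.transClass x = S.transClass y → f x = f y
  support : ∀ x, S.transClass x ∉ D → f x = 0
  nonneg : ∀ x, 0 ≤ f x
  posSemidef : (transMatrix f).PosSemidef

theorem transClass_zero (S : AssocScheme X) : S.transClass 0 = S.diag :=
  (S.classOf_eq_iff _ _).2 rfl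

theorem transClass_eq_diag_iff (S : AssocScheme X) {z : X} : S.transClass z = S.diag ↔ z = 0 :=
  S.classOf_eq_iff _ _

variable {S : AssocScheme X}

theorem IsTranslation.transClass_surjective (hS : S.IsTranslation) :
    Function.Surjective S.transClass := by
  intro r
  obtain ⟨⟨x, y⟩, hp⟩ : (r : Set (X × X)).Nonempty := by
    rw [Set.nonempty_iff_ne_empty]
    intro h
    exact S.isPartition.1 (h ▸ r.2)
  exact ⟨x - y, by rw [← hS.classOf_eq]; exact (S.classOf_eq_iff _ _).2 hp⟩

variable [Fintype X] [DecidableEq X]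

/-- Multiplication is convolution on an abelian group; the substitution `z ↦ x + y - z` swaps the
two factors. -/
theorem IsTranslation.boseMesner_commute (hS : S.IsTranslation) {M N : Matrix X X ℂ}
    (hM : M ∈ S.boseMesner) (hN : N ∈ S.boseMesner) : M * N = N * M := by
  obtain ⟨q, hq⟩ := (S.mem_boseMesner_iff M).1 hM
  obtain ⟨q', hq'⟩ := (S.mem_boseMesner_iff N).1 hN
  ext x y
  simp only [Matrix.mul_apply, hq, hq', hS.classOf_eq]
  refine Fintype.sum_equiv (Equiv.subLeft (x + y)) _ _ fun z => ?_
  rw [mul_comm, Equiv.subLeft_apply, show x - (x + y - z) = z - y by abel,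
    show x + y - z - y = x - z by abel]

theorem IsTranslation.conjTranspose_mem (hS : S.IsTranslation)
    (hneg : ∀ z, S.transClass (-z) = S.transClass z) {M : Matrix X X ℂ} (hM : M ∈ S.boseMesner) :
    M.conjTranspose ∈ S.boseMesner := by
  obtain ⟨q, hq⟩ := (S.mem_boseMesner_iff M).1 hM
  refine (S.mem_boseMesner_iff _).2 ⟨fun r => star (q r), fun x y => ?_⟩
  rw [Matrix.conjTranspose_apply, hq, hS.classOf_eq, hS.classOf_eq, ← hneg, neg_sub]

/-- By commutativity `E * Eᴴ` is an idempotent below `E`, and it is non-zero because `E` is;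
minimality leaves only `E`. Hence primitive idempotents are Hermitian and have positive trace. -/
theorem IsTranslation.mul_conjTranspose_eq (hS : S.IsTranslation)
    (hneg : ∀ z, S.transClass (-z) = S.transClass z) {E : Matrix X X ℂ}
    (hE : S.IsPrimitiveIdempotent E) : E * E.conjTranspose = E := by
  have hstar := hS.conjTranspose_mem hneg hE.mem
  have hcomm := hS.boseMesner_commute hE.mem hstar
  have hss : E.conjTranspose * E.conjTranspose = E.conjTranspose := by
    rw [← Matrix.conjTranspose_mul, hE.idem]
  have hl : E * (E * E.conjTranspose) = E * E.conjTranspose := by rw [← mul_assoc, hE.idem]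
  have hr : (E * E.conjTranspose) * E = E * E.conjTranspose := by
    rw [mul_assoc, ← hcomm, hl]
  rcases hE.minimal _ (mul_mem hE.mem hstar) (by rw [← mul_assoc, hr, mul_assoc, hss]) hl hr
    with h | h
  · exact absurd (Matrix.self_mul_conjTranspose_eq_zero.1 h) hE.ne_zero
  · exact h

/-- The link between the two forms of the program: up to the factor `|X|`, the MacWilliams sum of
`E` is a trace. -/
theorem IsTranslation.trace_transMatrix_mul (hS : S.IsTranslation)
    (hneg : ∀ z, S.transClass (-z) = S.transClass z) {E : Matrix X X ℂ} (hE : E ∈ S.boseMesner)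
    (f : X → ℝ) : (transMatrix f * E).trace =
      (Fintype.card X : ℝ) * ∑ z, S.qFunction hE (S.transClass z) * (f z : ℂ) := by
  simp only [Matrix.trace, Matrix.diag_apply, Matrix.mul_apply, S.apply_eq_qFunction hE,
    hS.classOf_eq, transMatrix, Matrix.of_apply]
  have : ∀ x : X, ∑ y, (f (x - y) : ℂ) * S.qFunction hE (S.transClass (y - x)) =
      ∑ z, S.qFunction hE (S.transClass z) * (f z : ℂ) := by
    intro x
    refine Fintype.sum_equiv (Equiv.subLeft x) _ _ fun y => ?_
    rw [Equiv.subLeft_apply, mul_comm, ← hneg (x - y), neg_sub]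
  simp [this]

/-- `f` has a positive semidefinite matrix if and only if it satisfies the MacWilliams
constraints. -/
theorem IsTranslation.posSemidef_transMatrix_iff (hS : S.IsTranslation)
    (hneg : ∀ z, S.transClass (-z) = S.transClass z) {f : X → ℝ}
    (hf : ∀ x y, S.transClass x = S.transClass y → f x = f y) :
    (transMatrix f).PosSemidef ↔ ∀ (E : Matrix X X ℂ) (hE : S.IsPrimitiveIdempotent E),
      0 ≤ ∑ z, S.qFunction hE.mem (S.transClass z) * (f z : ℂ) := by
  have hcard : (0 : ℂ) < (Fintype.card X : ℝ) := by
    have : 0 < Fintype.card X := Fintype.card_pos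
    exact_mod_cast this
  have htr : ∀ (E : Matrix X X ℂ) (hE : S.IsPrimitiveIdempotent E),
      (0 ≤ ∑ z, S.qFunction hE.mem (S.transClass z) * (f z : ℂ)) ↔
        0 ≤ (transMatrix f * E).trace := by
    intro E hE
    rw [hS.trace_transMatrix_mul hneg hE.mem, ← mul_le_mul_iff_right₀ hcard, mul_zero]
  have hEH : ∀ (E : Matrix X X ℂ), S.IsPrimitiveIdempotent E → E.conjTranspose = E := by
    intro E hE
    have h := hS.mul_conjTranspose_eq hneg hE
    rw [← h, Matrix.conjTranspose_mul, Matrix.conjTranspose_conjTranspose]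
  constructor
  · intro h E hE
    rw [htr E hE]
    -- As `E` is a Hermitian idempotent, the trace of `E A Eᴴ` is that of `A E`.
    have h2 := (h.mul_mul_conjTranspose_same E).trace_nonneg
    rwa [hEH E hE, Matrix.trace_mul_comm, ← mul_assoc, hE.idem, Matrix.trace_mul_comm] at h2
  · intro h
    have hmem : transMatrix f ∈ S.boseMesner := by
      refine (S.mem_boseMesner_iff _).2
        ⟨fun r => f (Function.surjInv hS.transClass_surjective r), fun x y => ?_⟩
      rw [hS.classOf_eq, transMatrix, Matrix.of_apply]
      exact congrArg _ (hf _ _ (Function.surjInv_eq hS.transClass_surjective _).symm)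
    have hA : (transMatrix f).IsHermitian := by
      ext x y
      rw [Matrix.conjTranspose_apply, transMatrix, Matrix.of_apply, Matrix.of_apply,
        hf (y - x) (x - y) (by rw [← hneg, neg_sub])]
      exact Complex.conj_ofReal _
    rw [hA.posSemidef_iff_eigenvalues_nonneg]
    intro i
    -- A primitive `E` below the eigenprojection satisfies `A E = λ E`, so the trace of `A E` is `λ`
    -- times the positive trace of `E`, which gives `λ` its sign.
    obtain ⟨P, hP, hPP, hP0, hAP⟩ := hA.exists_eigenprojection hmem i
    obtain ⟨E, hE, hPE⟩ := S.exists_isPrimitiveIdempotent hP hPP hP0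
    have h1 := (htr E hE).1 (h E hE)
    have hAE : transMatrix f * E = (hA.eigenvalues i : ℂ) • E := by
      rw [← hPE, ← mul_assoc, hAP, Matrix.smul_mul]
    have hpos : (0 : ℂ) < E.trace := by
      rw [← hS.mul_conjTranspose_eq hneg hE]
      exact lt_of_le_of_ne (Matrix.posSemidef_self_mul_conjTranspose E).trace_nonneg
        fun h0 => hE.ne_zero (Matrix.trace_mul_conjTranspose_self_eq_zero_iff.1 h0.symm)
    rw [hAE, Matrix.trace_smul, smul_eq_mul, ← zero_mul E.trace,
      mul_le_mul_iff_left₀ hpos] at h1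
    exact Complex.zero_le_real.1 h1

omit [DecidableEq X] in
theorem sum_mul_sum_fiber (S : AssocScheme X) {R : Type*} [CommSemiring R] (q : S.R → R)
    (f : X → R) [DecidableEq S.R] :
    ∑ r, q r * ∑ z with S.transClass z = r, f z = ∑ z, q (S.transClass z) * f z := by
  rw [← Finset.sum_fiberwise _ S.transClass]
  refine Finset.sum_congr rfl fun r _ => ?_
  rw [Finset.mul_sum]
  refine Finset.sum_congr rfl fun z hz => ?_
  rw [(Finset.mem_filter.1 hz).2]

/-- The variable `a r` is the total mass of `f` on the class `r`; conversely, `a r` is spread evenly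
over that class. The class of the diagonal is `{0}`, so normalizations match. -/
theorem IsTranslation.mem_delsarteValues_iff (hS : S.IsTranslation)
    (hneg : ∀ z, S.transClass (-z) = S.transClass z) (D : Set S.R) (v : ℝ) :
    v ∈ S.delsarteValues D ↔ ∃ f, S.IsDelsarteFunction D f ∧ v = ∑ x, f x := by
  classical
  have hsum : ∀ f : X → ℝ, ∑ r, ∑ z with S.transClass z = r, f z = ∑ z, f z := fun f =>
    Finset.sum_fiberwise _ _ _
  have hsumC : ∀ (q : S.R → ℂ) (f : X → ℝ),
      ∑ r, q r * ((∑ z with S.transClass z = r, f z : ℝ) : ℂ) =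
        ∑ z, q (S.transClass z) * (f z : ℂ) := fun q f => by
    rw [← S.sum_mul_sum_fiber q fun z => (f z : ℂ)]
    push_cast
    rfl
  constructor
  · rintro ⟨a, ha, rfl⟩
    let f : X → ℝ := fun z => a (S.transClass z) /
      ({w | S.transClass w = S.transClass z} : Finset X).card
    have hinv : ∀ x y, S.transClass x = S.transClass y → f x = f y := fun x y h => by
      simp only [f, h]
    have hfa : ∀ r, ∑ z with S.transClass z = r, f z = a r := by
      intro r
      obtain ⟨w, rfl⟩ := hS.transClass_surjective r
      rw [Finset.sum_congr rfl fun z hz => hinv z w (Finset.mem_filter.1 hz).2, Finset.sum_const,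
        nsmul_eq_mul]
      have : (({z | S.transClass z = S.transClass w} : Finset X).card : ℝ) ≠ 0 := by
        rw [Nat.cast_ne_zero, ← Nat.pos_iff_ne_zero]
        exact Finset.card_pos.2 ⟨w, by simp⟩
      simp only [f]
      field_simp
    refine ⟨f, ⟨?_, hinv, fun x hx => ?_, fun x => ?_, ?_⟩, ?_⟩
    · have h0 : ({w | S.transClass w = S.diag} : Finset X) = {0} := by
        ext w
        simp [transClass_eq_diag_iff]
      simp only [f, transClass_zero, h0, ha.normalization, Finset.card_singleton, Nat.cast_one,
        div_one]
    · simp [f, ha.code _ hx]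
    · exact div_nonneg (ha.nonneg _) (Nat.cast_nonneg _)
    · rw [hS.posSemidef_transMatrix_iff hneg hinv]
      intro E hE
      obtain ⟨t, ht, h⟩ := ha.macWilliams E hE
      simp only [← hsumC, hfa, h]
      exact Complex.zero_le_real.2 ht
    · simp only [← hsum f, hfa]
  · rintro ⟨f, hf, rfl⟩
    refine ⟨fun r => ∑ z with S.transClass z = r, f z, ⟨?_, fun r hr => ?_, fun E hE => ?_,
      fun r => Finset.sum_nonneg fun z _ => hf.nonneg z⟩, (hsum f).symm⟩
    · have h0 : ({w | S.transClass w = S.diag} : Finset X) = {0} := by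
        ext w
        simp [transClass_eq_diag_iff]
      rw [h0, Finset.sum_singleton, hf.map_zero]
    · exact Finset.sum_eq_zero fun z hz => hf.support z ((Finset.mem_filter.1 hz).2 ▸ hr)
    · rw [hsumC]
      have := (hS.posSemidef_transMatrix_iff hneg hf.invariant).1 hf.posSemidef E hE
      exact ⟨_, (Complex.nonneg_iff.1 this).1, Complex.ext rfl (Complex.nonneg_iff.1 this).2.symm⟩

end Translation

end AssocScheme

namespace AssocScheme

/-! ### Positive semidefinite functions on finite abelian groups. -/

section TransMatrix

variable {X Y : Type*} [AddCommGroup X] [AddCommGroup Y] [Fintype X] [Fintype Y]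

/-- Schur product theorem, one coordinate at a time: each factor is a pullback of the matrix of `f`,
and the empty product is the all-ones matrix of rank one. -/
theorem posSemidef_transMatrix_prod {l : ℕ} {f : X → ℝ} (hf : (transMatrix f).PosSemidef) :
    (transMatrix fun z : Fin l → X => ∏ i, f (z i)).PosSemidef := by
  suffices h : ∀ s : Finset (Fin l), (transMatrix fun z : Fin l → X => ∏ i ∈ s, f (z i)).PosSemidef
    from h Finset.univ
  intro s
  induction s using Finset.cons_induction with
  | empty =>
    convert Matrix.posSemidef_vecMulVec_self_star (fun _ : Fin l → X => (1 : ℂ)) using 1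
    ext x y
    simp [transMatrix, Matrix.vecMulVec_apply]
  | cons i s hi ih =>
    have h : (transMatrix fun z : Fin l → X => ∏ j ∈ Finset.cons i s hi, f (z j)) =
        ((transMatrix f).submatrix (fun z => z i) fun z => z i).hadamard
          (transMatrix fun z => ∏ j ∈ s, f (z j)) := by
      ext x y
      simp [transMatrix, -Finset.cons_eq_insert, Finset.prod_cons]
    rw [h]
    exact (hf.submatrix _).hadamard ih

open Classical in
/-- Positive semidefiniteness is preserved by summing over the fibres of a homomorphism that is
defined on a subgroup. -/
theorem posSemidef_transMatrix_sum_fiber {g : Y → ℝ} (hg : (transMatrix g).PosSemidef)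
    (U : AddSubgroup Y) (π : Y →+ X) (hπ : ∀ x, ∃ u ∈ U, π u = x) :
    (transMatrix fun x => ∑ u with u ∈ U ∧ π u = x, g u).PosSemidef := by
  let B : Matrix X Y ℂ := Matrix.of fun x u => if u ∈ U ∧ π u = x then 1 else 0
  let N : ℕ := ({u | u ∈ U ∧ π u = 0} : Finset Y).card
  have hsub : ∀ u v, v ∈ U → (u - v ∈ U ↔ u ∈ U) := fun u v hv => by
    rw [sub_eq_add_neg, U.add_mem_cancel_right (U.neg_mem hv)]
  have hN : ∀ x, ({u | u ∈ U ∧ π u = x} : Finset Y).card = N := by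
    intro x
    obtain ⟨v, hv, rfl⟩ := hπ x
    refine Finset.card_equiv (Equiv.subRight v) fun u => ?_
    simp only [Finset.mem_filter_univ, Equiv.subRight_apply, map_sub, sub_eq_zero, hsub u v hv]
  have hN0 : 0 < N := Finset.card_pos.2 ⟨0, by simp⟩
  -- The entry at `(x, x')` sums `g (u - v)` over `u`, `v` in `U` above `x`, `x'`. For fixed `v`,
  -- the difference `u - v` runs through the fibre of `U` above `x - x'`; there are `N` choices of
  -- `v`.
  have key : B * transMatrix g * B.conjTranspose =
      (N : ℂ) • transMatrix fun x => ∑ u with u ∈ U ∧ π u = x, g u := by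
    ext x x'
    have h1 : ∀ v, v ∈ U ∧ π v = x' → (B * transMatrix g) x v =
        ((∑ u with u ∈ U ∧ π u = x - x', g u : ℝ) : ℂ) := by
      rintro v ⟨hv, rfl⟩
      simp only [Matrix.mul_apply, B, Matrix.of_apply, transMatrix, ite_mul, one_mul, zero_mul]
      rw [← Finset.sum_filter]
      push_cast
      refine Finset.sum_equiv (Equiv.subRight v) (fun u => ?_) fun u _ => rfl
      simp only [Finset.mem_filter_univ, Equiv.subRight_apply, map_sub, sub_left_inj, hsub u v hv]
    rw [Matrix.mul_apply]
    simp only [Matrix.conjTranspose_apply, B, Matrix.of_apply, apply_ite star, star_one, star_zero,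
      mul_ite, mul_one, mul_zero]
    rw [← Finset.sum_filter, Finset.sum_congr rfl fun v hv => h1 v (Finset.mem_filter.1 hv).2,
      Finset.sum_const, hN]
    simp [transMatrix]
  have h := (hg.mul_mul_conjTranspose_same B).smul (a := ((N : ℝ)⁻¹ : ℂ)) (by positivity)
  rw [key, smul_smul, Complex.ofReal_natCast, inv_mul_cancel₀ (by exact_mod_cast hN0.ne'),
    one_smul] at h
  exact h

/-- The quadratic form at `δ_x - δ_0` is `2 f 0 - 2 f x`. -/
theorem apply_le_of_posSemidef_transMatrix {f : X → ℝ} (hf : (transMatrix f).PosSemidef) (x : X) :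
    f x ≤ f 0 := by
  classical
  have hneg : f (-x) = f x := by
    have := hf.1.apply x 0
    simpa [transMatrix] using this
  have h := hf.dotProduct_mulVec_nonneg (Pi.single x 1 - Pi.single 0 1)
  have h2 : (0 : ℂ) ≤ ((2 * f 0 - 2 * f x : ℝ) : ℂ) := by
    convert h using 1
    simp [Matrix.mulVec_sub, sub_dotProduct, dotProduct_sub, transMatrix, hneg]
    ring
  have := Complex.zero_le_real.1 h2
  linarith

end TransMatrix

/-! ### Existence of optimal solutions by compactness. -/

section Attained

variable {X : Type*} [AddCommGroup X] [Fintype X] {S : AssocScheme X}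

omit [Fintype X] in
-- Provides a feasible point: its matrix is the identity.
theorem isDelsarteFunction_single [DecidableEq X] {D : Set S.R} (hD : S.diag ∈ D) :
    S.IsDelsarteFunction D (Pi.single 0 1) where
  map_zero := by simp
  invariant x y h := by
    by_cases hx : x = 0
    · have hy : y = 0 := S.transClass_eq_diag_iff.1 (h ▸ S.transClass_eq_diag_iff.2 hx)
      rw [hx, hy]
    · have hy : y ≠ 0 := fun hy => hx (S.transClass_eq_diag_iff.1 (h ▸ S.transClass_eq_diag_iff.2 hy))
      simp [hx, hy]
  support x hx := by
    have : x ≠ 0 := fun h => hx (S.transClass_eq_diag_iff.2 h ▸ hD)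
    simp [this]
  nonneg x := by
    by_cases hx : x = 0 <;> simp [hx]
  posSemidef := by
    convert Matrix.PosSemidef.one (n := X) (R := ℂ) using 1
    ext x y
    by_cases h : x = y
    · simp [h, transMatrix, Matrix.one_apply]
    · simp [h, transMatrix, sub_eq_zero]

/-- All constraints are closed conditions, and they confine `f` to the cube `[0, 1] ^ X`. -/
theorem isCompact_isDelsarteFunction (D : Set S.R) : IsCompact {f | S.IsDelsarteFunction D f} := by
  have hset : {f | S.IsDelsarteFunction D f} = {f : X → ℝ | f 0 = 1} ∩
      {f | ∀ x y, S.transClass x = S.transClass y → f x = f y} ∩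
      {f | ∀ x, S.transClass x ∉ D → f x = 0} ∩ {f | ∀ x, 0 ≤ f x} ∩
      {f | (transMatrix f).PosSemidef} := by
    ext f
    exact ⟨fun h => ⟨⟨⟨⟨h.1, h.2⟩, h.3⟩, h.4⟩, h.5⟩, fun h => ⟨h.1.1.1.1, h.1.1.1.2, h.1.1.2, h.1.2, h.2⟩⟩
  have hcont : Continuous fun f : X → ℝ => transMatrix f := by
    refine continuous_matrix fun i j => ?_
    exact Complex.continuous_ofReal.comp (continuous_apply _)
  have hpsd : IsClosed {f : X → ℝ | (transMatrix f).PosSemidef} := by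
    simp only [Matrix.posSemidef_iff_dotProduct_mulVec, Matrix.IsHermitian, Set.ofPred_and,
      Set.ofPred_forall]
    refine (isClosed_eq hcont.matrix_conjTranspose hcont).inter
      (isClosed_iInter fun w => isClosed_le continuous_const ?_)
    exact continuous_const.dotProduct (hcont.matrix_mulVec continuous_const)
  have hclosed : IsClosed {f | S.IsDelsarteFunction D f} := by
    rw [hset]
    refine (((IsClosed.inter ?_ ?_).inter ?_).inter ?_).inter hpsd
    · exact isClosed_eq (continuous_apply 0) continuous_const
    · simp only [Set.ofPred_forall]
      exact isClosed_iInter fun x => isClosed_iInter fun y => isClosed_iInter fun _ =>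
        isClosed_eq (continuous_apply x) (continuous_apply y)
    · simp only [Set.ofPred_forall]
      exact isClosed_iInter fun x => isClosed_iInter fun _ =>
        isClosed_eq (continuous_apply x) continuous_const
    · simp only [Set.ofPred_forall]
      exact isClosed_iInter fun x => isClosed_le continuous_const (continuous_apply x)
  refine (isCompact_univ_pi fun _ : X => isCompact_Icc (a := (0 : ℝ)) (b := 1)).of_isClosed_subset
    hclosed fun f hf x _ => ⟨hf.nonneg x, ?_⟩
  rw [← hf.map_zero]
  exact apply_le_of_posSemidef_transMatrix hf.posSemidef x

/-- The Delsarte linear program of a symmetric translation scheme attains its maximum. -/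
theorem IsTranslation.isGreatest_delsarteVal [DecidableEq X] (hS : S.IsTranslation)
    (hneg : ∀ z, S.transClass (-z) = S.transClass z) {D : Set S.R} (hD : S.diag ∈ D) :
    IsGreatest (S.delsarteValues D) (S.delsarteVal D) := by
  have hval : S.delsarteValues D = (fun f : X → ℝ => ∑ x, f x) '' {f | S.IsDelsarteFunction D f} := by
    ext v
    rw [hS.mem_delsarteValues_iff hneg]
    exact exists_congr fun f => and_congr_right fun _ => eq_comm
  have hc : IsCompact (S.delsarteValues D) := by
    rw [hval]
    exact (isCompact_isDelsarteFunction D).image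
      (continuous_finsetSum _ fun x _ => continuous_apply x)
  have hne : (S.delsarteValues D).Nonempty := by
    rw [hval]
    exact ⟨_, _, isDelsarteFunction_single hD, rfl⟩
  exact hc.isGreatest_sSup hne

end Attained

/-! ### Refined tensor powers -/

section RefinedPower

variable {X : Type*} [AddCommGroup X] {K : Type*} [Ring K] [Module K X] {l : ℕ}
  {S : AssocScheme X} {T : Set (Fin l → K)}

theorem config_neg (hneg : ∀ z, S.transClass (-z) = S.transClass z) (z : Fin l → X) :
    S.config T (-z) = S.config T z := by
  funext k
  simp [config, Finset.sum_neg_distrib, hneg]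

theorem transClass_eq_of_config_eq (hT : ∀ i : Fin l, Pi.single i 1 ∈ T) {z w : Fin l → X}
    (h : S.config T z = S.config T w) (i : Fin l) : S.transClass (z i) = S.transClass (w i) := by
  have := congrFun h ⟨Pi.single i 1, hT i⟩
  simpa [config, Pi.single_apply, ite_smul] using this

variable [Finite X] (hT : ∀ i : Fin l, Pi.single i 1 ∈ T) (hf : S.FactorsThroughTypes T)

theorem refinedPower_isTranslation : (S.refinedPower T hT hf).IsTranslation := by
  rintro _ ⟨⟨h, rfl⟩, -⟩ x y z
  simp [refinedRel]

theorem coe_refinedPower_transClass (z : Fin l → X) :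
    ((S.refinedPower T hT hf).transClass z : Set _) = S.refinedRel T (S.config T z) := by
  refine ((S.refinedPower T hT hf).eq_classOf (p := (z, 0)) ⟨⟨_, rfl⟩, ?_⟩ ?_).symm
  · exact Set.Nonempty.ne_empty ⟨(z, 0), by simp [refinedRel]⟩
  · simp [refinedRel]

theorem refinedPower_transClass_eq_iff (z w : Fin l → X) :
    (S.refinedPower T hT hf).transClass z = (S.refinedPower T hT hf).transClass w ↔
      S.config T z = S.config T w := by
  rw [Subtype.ext_iff, coe_refinedPower_transClass, coe_refinedPower_transClass]
  constructor
  · intro h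
    have : (z, (0 : Fin l → X)) ∈ S.refinedRel T (S.config T z) := by simp [refinedRel]
    rw [h] at this
    simpa [refinedRel] using this
  · intro h
    rw [h]

/-- The relations of a refined tensor power that are contained in a tensor product of relations
from `D`. -/
def tensorRels (D : Set S.R) : Set (S.refinedPower T hT hf).R :=
  {r | ∃ s : Fin l → S.R, (∀ i, s i ∈ D) ∧
    (r : Set _) ⊆ tensorRel fun i => (s i : Set (X × X))}

/-- Since `T` contains the unit vectors, a refined relation determines the class of each coordinate,
so only one tensor product can contain it. -/
theorem refinedPower_transClass_mem_tensorRels_iff (hS : S.IsTranslation) (D : Set S.R)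
    (z : Fin l → X) : (S.refinedPower T hT hf).transClass z ∈ tensorRels hT hf D ↔
      ∀ i, S.transClass (z i) ∈ D := by
  simp only [tensorRels, Set.mem_ofPred_eq, coe_refinedPower_transClass]
  constructor
  · rintro ⟨s, hs, h⟩ i
    have h0 : (z, (0 : Fin l → X)) ∈ S.refinedRel T (S.config T z) := by simp [refinedRel]
    have : S.transClass (z i) = s i := (S.classOf_eq_iff _ _).2 (h h0 i)
    rw [this]
    exact hs i
  · intro h
    refine ⟨fun i => S.transClass (z i), h, fun p hp i => ?_⟩
    have h1 := transClass_eq_of_config_eq hT (show S.config T (p.1 - p.2) = S.config T z from hp) i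
    change _ ∈ (S.transClass (z i) : Set (X × X))
    rw [← h1]
    exact hS.mem_transClass _ _

end RefinedPower

/-! ### Both bounds for the optimum of a refined tensor power. -/

section Lifting

variable {X : Type*} [AddCommGroup X] [Fintype X] {K : Type*} [Ring K] [Module K X] {l : ℕ}
  {S : AssocScheme X} {T : Set (Fin l → K)} (hT : ∀ i : Fin l, Pi.single i 1 ∈ T)
  (hf : S.FactorsThroughTypes T)

theorem IsDelsarteFunction.tensorPower (hS : S.IsTranslation) {D : Set S.R} {f : X → ℝ}
    (h : S.IsDelsarteFunction D f) :
    (S.refinedPower T hT hf).IsDelsarteFunction (tensorRels hT hf D) fun z => ∏ i, f (z i) where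
  map_zero := by simp [h.map_zero]
  invariant z w hzw := by
    rw [refinedPower_transClass_eq_iff] at hzw
    exact Finset.prod_congr rfl fun i _ => h.invariant _ _ (transClass_eq_of_config_eq hT hzw i)
  support z hz := by
    rw [refinedPower_transClass_mem_tensorRels_iff hT hf hS] at hz
    push Not at hz
    obtain ⟨i, hi⟩ := hz
    exact Finset.prod_eq_zero (Finset.mem_univ i) (h.support _ hi)
  nonneg z := Finset.prod_nonneg fun i _ => h.nonneg _
  posSemidef := posSemidef_transMatrix_prod h.posSemidef

/-- Freeing one more coordinate multiplies the sum of a Delsarte function of a refined tensor power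
by at most the optimum `v` of the scheme: the marginal at that coordinate is, up to scaling, a
Delsarte function of the scheme. -/
theorem IsDelsarteFunction.sum_le_of_marginal (hS : S.IsTranslation)
    (htrans : ∀ x y, S.transClass x = S.transClass y → ∃ σ : X ≃ₗ[K] X, S.IsAut σ ∧ σ x = y)
    {D : Set S.R} {v : ℝ} (hv : ∀ f, S.IsDelsarteFunction D f → ∑ x, f x ≤ v)
    {g : (Fin l → X) → ℝ}
    (hg : (S.refinedPower T hT hf).IsDelsarteFunction (tensorRels hT hf D) g) (k : Fin l)
    [DecidableEq X] :
    ∑ y with (∀ i, k < i → y i = 0), g y ≤ v * ∑ y with (∀ i, k ≤ i → y i = 0), g y := by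
  classical
  -- Tuples vanishing after coordinate `k`; `f` below is the push-forward of `g` restricted to `U`
  -- along that coordinate.
  let U : AddSubgroup (Fin l → X) :=
    { carrier := {y | ∀ i, k < i → y i = 0}
      add_mem' := fun {a b} ha hb i hi => by simp [ha i hi, hb i hi]
      zero_mem' := fun i _ => rfl
      neg_mem' := fun {a} ha i hi => by simp [ha i hi] }
  have hU : ∀ y, y ∈ U ↔ ∀ i, k < i → y i = 0 := fun y => Iff.rfl
  let π : (Fin l → X) →+ X := Pi.evalAddMonoidHom (fun _ => X) k
  let f : X → ℝ := fun x => ∑ y with y ∈ U ∧ π y = x, g y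
  have hfpsd : (transMatrix f).PosSemidef := by
    convert posSemidef_transMatrix_sum_fiber hg.posSemidef U π fun x =>
      ⟨Pi.single k x, fun i (hi : k < i) => Pi.single_eq_of_ne hi.ne' x, by simp [π]⟩
  have hf0 : f 0 = ∑ y with (∀ i, k ≤ i → y i = 0), g y := by
    refine Finset.sum_congr (Finset.filter_congr fun y _ => ⟨?_, fun h => ?_⟩) fun _ _ => rfl
    · rintro ⟨h1, h2⟩ i hi
      rcases hi.eq_or_lt with rfl | hi
      · exact h2
      · exact h1 i hi
    · exact ⟨fun i hi => h i hi.le, h k le_rfl⟩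
  have hsum : ∑ x, f x = ∑ y with (∀ i, k < i → y i = 0), g y := by
    rw [← Finset.sum_fiberwise (Finset.univ.filter fun y : Fin l → X => ∀ i, k < i → y i = 0) π]
    refine Finset.sum_congr rfl fun x _ => ?_
    rw [Finset.filter_filter]
    exact Finset.sum_congr (Finset.filter_congr fun y _ => Iff.rfl) fun _ _ => rfl
  have hpos : 0 < f 0 := by
    rw [hf0]
    refine lt_of_lt_of_le zero_lt_one (hg.map_zero.symm.le.trans ?_)
    exact Finset.single_le_sum (fun y _ => hg.nonneg y)
      (Finset.mem_filter.2 ⟨Finset.mem_univ _, fun i _ => rfl⟩)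
  have hginv : ∀ σ : X ≃ₗ[K] X, S.IsAut σ → ∀ y, g (fun i => σ (y i)) = g y := by
    intro σ hσ y
    refine hg.invariant _ _ ?_
    rw [refinedPower_transClass_eq_iff]
    exact ((hf _ _).2 ⟨σ, hσ, fun _ => rfl⟩).symm
  have hh : S.IsDelsarteFunction D fun x => (f 0)⁻¹ * f x :=
    { map_zero := inv_mul_cancel₀ hpos.ne'
      invariant := by
        intro x x' hx
        -- Applied to all coordinates, `σ` maps the fibre of `U` over `x` onto the one over `σ x`
        -- and preserves `g`.
        obtain ⟨σ, hσ, rfl⟩ := htrans x x' hx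
        congr 1
        refine Finset.sum_equiv (Equiv.piCongrRight fun _ => σ.toEquiv) (fun y => ?_)
          fun y _ => (hginv σ hσ y).symm
        simp [hU, π]
      support := by
        intro x hx
        rw [mul_eq_zero]
        right
        refine Finset.sum_eq_zero fun y hy => hg.support y fun hmem => hx ?_
        rw [refinedPower_transClass_mem_tensorRels_iff hT hf hS] at hmem
        rw [← (Finset.mem_filter.1 hy).2.2]
        exact hmem k
      nonneg := fun x => mul_nonneg (inv_nonneg.2 hpos.le)
        (Finset.sum_nonneg fun y _ => hg.nonneg y)
      posSemidef := by
        convert hfpsd.smul (a := (((f 0)⁻¹ : ℝ) : ℂ))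
          (Complex.zero_le_real.2 (inv_nonneg.2 hpos.le)) using 1
        ext x y
        simp [transMatrix] }
  have := hv _ hh
  rw [← Finset.mul_sum, inv_mul_le_iff₀ hpos, hsum, hf0, mul_comm] at this
  exact this

theorem IsDelsarteFunction.sum_le_pow (hS : S.IsTranslation)
    (htrans : ∀ x y, S.transClass x = S.transClass y → ∃ σ : X ≃ₗ[K] X, S.IsAut σ ∧ σ x = y)
    {D : Set S.R} {v : ℝ} (hv0 : 0 ≤ v) (hv : ∀ f, S.IsDelsarteFunction D f → ∑ x, f x ≤ v)
    {g : (Fin l → X) → ℝ}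
    (hg : (S.refinedPower T hT hf).IsDelsarteFunction (tensorRels hT hf D) g) :
    ∑ y, g y ≤ v ^ l := by
  classical
  have key : ∀ m ≤ l, ∑ y with (∀ i : Fin l, m ≤ i → y i = 0), g y ≤ v ^ m := by
    intro m
    induction m with
    | zero =>
      intro _
      have : ({y | ∀ i : Fin l, 0 ≤ (i : ℕ) → y i = 0} : Finset (Fin l → X)) = {0} := by
        ext y
        simp [funext_iff]
      rw [this, Finset.sum_singleton, hg.map_zero, pow_zero]
    | succ m ih =>
      intro hm
      -- In the natural numbers `m < i` is `m + 1 ≤ i`, so the left side is already the sum for `m +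
      -- 1`.
      have h := IsDelsarteFunction.sum_le_of_marginal hT hf hS htrans hv hg ⟨m, hm⟩
      simp only [Fin.lt_def, Fin.le_def] at h
      exact h.trans (by rw [pow_succ']; exact mul_le_mul_of_nonneg_left (ih (by omega)) hv0)
  have := key l le_rfl
  -- For `m = l` the vanishing condition is vacuous.
  rwa [Finset.filter_true_of_mem fun y _ i hi => absurd i.2 (by omega)] at this

/-- **Hierarchy collapse**: the Delsarte linear program of a refined tensor power has the value
`v ^ l` if the one of the scheme has the value `v`. -/
theorem IsTranslation.isGreatest_refinedPower [DecidableEq X] (hS : S.IsTranslation)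
    (hneg : ∀ z, S.transClass (-z) = S.transClass z)
    (htrans : ∀ x y, S.transClass x = S.transClass y → ∃ σ : X ≃ₗ[K] X, S.IsAut σ ∧ σ x = y)
    {D : Set S.R} {v : ℝ} (hv : IsGreatest (S.delsarteValues D) v) :
    IsGreatest ((S.refinedPower T hT hf).delsarteValues (tensorRels hT hf D)) (v ^ l) := by
  have hS' := refinedPower_isTranslation hT hf
  have hneg' : ∀ z, (S.refinedPower T hT hf).transClass (-z) =
      (S.refinedPower T hT hf).transClass z := fun z =>
    (refinedPower_transClass_eq_iff hT hf _ _).2 (config_neg hneg z)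
  obtain ⟨f, hfD, rfl⟩ := (hS.mem_delsarteValues_iff hneg D v).1 hv.1
  constructor
  · rw [hS'.mem_delsarteValues_iff hneg']
    exact ⟨_, hfD.tensorPower hT hf hS, Fintype.sum_pow f l⟩
  · intro w hw
    obtain ⟨g, hg, rfl⟩ := (hS'.mem_delsarteValues_iff hneg' _ w).1 hw
    exact hg.sum_le_pow hT hf hS htrans (Finset.sum_nonneg fun x _ => hfD.nonneg x)
      fun f' hf' => hv.2 ((hS.mem_delsarteValues_iff hneg D _).2 ⟨f', hf', rfl⟩)

end Lifting

end AssocScheme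

/-! ### Application to the weak Hamming scheme. -/

section Hamming

variable (F : Type*) [Field F] [Fintype F] [DecidableEq F]

theorem hammingScheme_transClass_neg {n : ℕ} (z : Fin n → F) :
    (hammingScheme F n).transClass (-z) = (hammingScheme F n).transClass z := by
  rw [hammingScheme_transClass_eq_iff, hammingDist_zero_right, hammingDist_zero_right]
  simp [hammingNorm]

/-- The case of one-tuples in `hammingScheme_factorsThroughTypes`: all multiples of `x` and `y` have
matching weights because non-zero scalars preserve weight. -/
theorem hammingScheme_exists_isAut {n : ℕ} (x y : Fin n → F)
    (h : (hammingScheme F n).transClass x = (hammingScheme F n).transClass y) :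
    ∃ σ : (Fin n → F) ≃ₗ[F] (Fin n → F), (hammingScheme F n).IsAut σ ∧ σ x = y := by
  obtain ⟨σ, hσ, hxy⟩ := (hammingScheme_factorsThroughTypes F n 1 (fun _ => x) fun _ => y).1 (by
    funext k
    simp only [AssocScheme.config, Finset.univ_unique, Finset.sum_singleton]
    by_cases hk : (k : Fin 1 → F) default = 0
    · rw [hk, zero_smul, zero_smul]
    · rw [hammingScheme_transClass_eq_iff] at h ⊢
      simp only [hammingDist_zero_right] at h ⊢
      have hsmul : ∀ z : Fin n → F, hammingNorm ((k : Fin 1 → F) default • z) = hammingNorm z :=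
        fun z => hammingNorm_smul (fun _ => (isUnit_iff_ne_zero.2 hk).isSMulRegular _) z
      rw [hsmul, hsmul, h])
  exact ⟨σ, hσ, hxy 0⟩

theorem diag_mem_distRels (n d : ℕ) : (hammingScheme F n).diag ∈ distRels F n d :=
  ⟨0, Nat.zero_le _, Or.inl rfl, by
    ext p
    simp [hammingRel, AssocScheme.diag]⟩

end Hamming

theorem proposition6p5 (F : Type*) [Field F] [Fintype F] [DecidableEq F] (n d l : ℕ)
    (hn : 0 < n) (hd : d ≤ n) (hl : 0 < l) :
    IsGreatest (krawtchoukLPValues F n d l) (krawtchoukLPVal F n d l) ∧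
    IsGreatest (delsarteLPValues F n d) (delsarteLPVal F n d) ∧
    (krawtchoukLPVal F n d l) ^ ((1 : ℝ) / (l : ℝ)) = delsarteLPVal F n d := by
  have hS := hammingScheme_isTranslation F n
  have hneg := hammingScheme_transClass_neg F (n := n)
  have hD : IsGreatest (delsarteLPValues F n d) (delsarteLPVal F n d) :=
    hS.isGreatest_delsarteVal hneg (diag_mem_distRels F n d)
  -- `tensorDistRels` is by definition `tensorRels` for `D = distRels F n d`, so the general result
  -- applies directly.
  have hK : IsGreatest (krawtchoukLPValues F n d l) (delsarteLPVal F n d ^ l) :=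
    hS.isGreatest_refinedPower (fun _ => Set.mem_univ _)
      (hammingScheme_factorsThroughTypes F n l) hneg
      (hammingScheme_exists_isAut F) hD
  have hval : krawtchoukLPVal F n d l = delsarteLPVal F n d ^ l := hK.csSup_eq
  have hnonneg : 0 ≤ delsarteLPVal F n d := by
    obtain ⟨a, ha, h⟩ := hD.1
    rw [h]
    exact Finset.sum_nonneg fun r _ => ha.nonneg r
  refine ⟨hval ▸ hK, hD, ?_⟩
  rw [hval, one_div, Real.pow_rpow_inv_natCast hnonneg hl.ne']
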